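/- Let $U$ be a path-connected topological space having the homotopy type of a CW complex, let $u\in U$, and let $G=\pi_1(U,u)$. Let $n\ge 0$ be an integer and suppose that 1. the abelianization $G/G'$ is a free abelian group of rank $n$; 2. $G$ can be generated by $n$ elements; 3. the homomorphism $H_2(U;\mathbb{Z})\to H_1(U;\mathbb{Z})\otimes_{\mathbb{Z}} H_1(U;\mathbb{Z})$ induced by the (Alexander–Whitney) comultiplication of the singular chain complex of $U$ is injective. Let $\gamma_1G=G$ and $\gamma_{k+1}G=(G,\gamma_kG)$ be the lower central series of $G$, and let $I$ be the augmentation ideal of the group ring $\mathbb{Z}G$, that is, the kernel of the ring homomorphism $\mathbb{Z}G\to\mathbb{Z}$ sending every $g\in G$ to $1$. Then for $k=1,2,3,4$ $$\gamma_kG=\{\,g\in G : g-1\in I^k\,\}.$$ -/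

import Mathlib

open CategoryTheory Simplicial TensorProduct

universe u

noncomputable section

/-! ### Integral chains of a simplicial set -/

/-- The free abelian group of `n`-chains of the simplicial set `X`. -/
abbrev SChain (X : SSet.{u}) (n : ℕ) : Type u := (X _⦋n⦌) →₀ ℤ

/-- The boundary `∂ = ∑ (-1)^i d_i : C_{n+1} → C_n`. -/
def sBoundary (X : SSet.{u}) (n : ℕ) : SChain X (n + 1) →ₗ[ℤ] SChain X n :=
  ∑ i : Fin (n + 2), (-1 : ℤ) ^ (i : ℕ) • Finsupp.lmapDomain ℤ ℤ (fun σ => X.δ i σ)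

/-- The homology `H_{n+1}(X; ℤ) = ker (C_{n+1} → C_n) / im (C_{n+2} → C_{n+1})`. -/
abbrev SHomologySucc (X : SSet.{u}) (n : ℕ) : Type u :=
  LinearMap.ker (sBoundary X n) ⧸
    (LinearMap.range (sBoundary X (n + 1))).submoduleOf (LinearMap.ker (sBoundary X n))

/-- The component `C_2 → C_1 ⊗ C_1` of the Alexander–Whitney comultiplication: a `2`-simplex with
vertices `0, 1, 2` goes to (front edge `01`) `⊗` (back edge `12`). -/
def alexanderWhitney (X : SSet.{u}) : SChain X 2 →ₗ[ℤ] SChain X 1 ⊗[ℤ] SChain X 1 :=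
  Finsupp.linearCombination ℤ fun σ =>
    Finsupp.single (X.δ 2 σ) (1 : ℤ) ⊗ₜ[ℤ] Finsupp.single (X.δ 0 σ) (1 : ℤ)

/-- `ρ : C_1 → H_1` is a retraction if it sends every `1`-cycle to its homology class. Since `ρ`
kills boundaries, it is (together with the augmentation in degree `0`) the low-degree part of a
chain map from the chains to their homology which induces the identity on `H_1`. -/
def IsHomologyRetraction (X : SSet.{u}) (ρ : SChain X 1 →ₗ[ℤ] SHomologySucc X 0) : Prop :=
  ∀ z : LinearMap.ker (sBoundary X 0), ρ z = Submodule.Quotient.mk z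

lemma sBoundary_zero_single (X : SSet.{u}) (σ : X _⦋1⦌) :
    sBoundary X 0 (Finsupp.single σ 1) =
      Finsupp.single (X.δ 0 σ) 1 - Finsupp.single (X.δ 1 σ) 1 := by
  simp [sBoundary, Fin.sum_univ_succ, Finsupp.mapDomain_single, sub_eq_add_neg]

lemma sBoundary_one_single (X : SSet.{u}) (σ : X _⦋2⦌) :
    sBoundary X 1 (Finsupp.single σ 1) =
      Finsupp.single (X.δ 0 σ) 1 - Finsupp.single (X.δ 1 σ) 1 + Finsupp.single (X.δ 2 σ) 1 := by
  simp only [sBoundary, LinearMap.sum_apply, LinearMap.smul_apply, Finsupp.lmapDomain_apply,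
    Finsupp.mapDomain_single]
  rw [Fin.sum_univ_three]
  simp [sub_eq_add_neg]

lemma sBoundary_two_single (X : SSet.{u}) (σ : X _⦋3⦌) :
    sBoundary X 2 (Finsupp.single σ 1) =
      Finsupp.single (X.δ 0 σ) 1 - Finsupp.single (X.δ 1 σ) 1 + Finsupp.single (X.δ 2 σ) 1
        - Finsupp.single (X.δ 3 σ) 1 := by
  simp only [sBoundary, LinearMap.sum_apply, LinearMap.smul_apply, Finsupp.lmapDomain_apply,
    Finsupp.mapDomain_single]
  rw [Fin.sum_univ_four]
  simp [sub_eq_add_neg, pow_succ]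

lemma sδ_comm (X : SSet.{u}) {n : ℕ} (i j : Fin (n + 2)) (h : i ≤ j) (σ : X _⦋n + 2⦌) :
    X.δ i (X.δ j.succ σ) = X.δ j (X.δ i.castSucc σ) :=
  ConcreteCategory.congr_hom (X.δ_comp_δ h) σ

lemma sBoundary_zero_one (X : SSet.{u}) (c : SChain X 2) :
    sBoundary X 0 (sBoundary X 1 c) = 0 := by
  suffices h : (sBoundary X 0) ∘ₗ (sBoundary X 1) = 0 from LinearMap.congr_fun h c
  refine Finsupp.lhom_ext' fun σ => LinearMap.ext_ring ?_
  have h1 : X.δ 0 (X.δ 1 σ) = X.δ 0 (X.δ 0 σ) := sδ_comm X 0 0 le_rfl σ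
  have h2 : X.δ 0 (X.δ 2 σ) = X.δ 1 (X.δ 0 σ) := sδ_comm X 0 1 (by decide) σ
  have h3 : X.δ 1 (X.δ 2 σ) = X.δ 1 (X.δ 1 σ) := sδ_comm X 1 1 le_rfl σ
  change sBoundary X 0 (sBoundary X 1 (Finsupp.single σ 1)) = 0
  rw [sBoundary_one_single, map_add, map_sub, sBoundary_zero_single, sBoundary_zero_single,
    sBoundary_zero_single, h1, h2, h3]
  abel

/-- A retraction kills boundaries. -/
lemma IsHomologyRetraction.boundary {X : SSet.{u}} {ρ : SChain X 1 →ₗ[ℤ] SHomologySucc X 0}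
    (hρ : IsHomologyRetraction X ρ) (c : SChain X 2) : ρ (sBoundary X 1 c) = 0 := by
  rw [hρ ⟨sBoundary X 1 c, sBoundary_zero_one X c⟩, Submodule.Quotient.mk_eq_zero]
  exact ⟨c, rfl⟩

lemma IsHomologyRetraction.face {X : SSet.{u}} {ρ : SChain X 1 →ₗ[ℤ] SHomologySucc X 0}
    (hρ : IsHomologyRetraction X ρ) (σ : X _⦋2⦌) :
    ρ (Finsupp.single (X.δ 1 σ) 1) =
      ρ (Finsupp.single (X.δ 2 σ) 1) + ρ (Finsupp.single (X.δ 0 σ) 1) := by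
  have h := hρ.boundary (Finsupp.single σ 1)
  rw [sBoundary_one_single, map_add, map_sub] at h
  rw [← sub_eq_zero, ← neg_eq_zero, ← h]
  abel

lemma alexanderWhitney_single (X : SSet.{u}) (σ : X _⦋2⦌) :
    alexanderWhitney X (Finsupp.single σ 1) =
      Finsupp.single (X.δ 2 σ) (1 : ℤ) ⊗ₜ[ℤ] Finsupp.single (X.δ 0 σ) (1 : ℤ) := by
  simp [alexanderWhitney]

lemma IsHomologyRetraction.comult_boundary {X : SSet.{u}}
    {ρ : SChain X 1 →ₗ[ℤ] SHomologySucc X 0} (hρ : IsHomologyRetraction X ρ) (c : SChain X 3) :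
    TensorProduct.map ρ ρ (alexanderWhitney X (sBoundary X 2 c)) = 0 := by
  suffices h : TensorProduct.map ρ ρ ∘ₗ alexanderWhitney X ∘ₗ sBoundary X 2 = 0 from
    LinearMap.congr_fun h c
  refine Finsupp.lhom_ext' fun σ => LinearMap.ext_ring ?_
  have h00 : X.δ 0 (X.δ 1 σ) = X.δ 0 (X.δ 0 σ) := sδ_comm X 0 0 (by decide) σ
  have h01 : X.δ 0 (X.δ 2 σ) = X.δ 1 (X.δ 0 σ) := sδ_comm X 0 1 (by decide) σ
  have h02 : X.δ 0 (X.δ 3 σ) = X.δ 2 (X.δ 0 σ) := sδ_comm X 0 2 (by decide) σ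
  have h12 : X.δ 1 (X.δ 3 σ) = X.δ 2 (X.δ 1 σ) := sδ_comm X 1 2 (by decide) σ
  have h22 : X.δ 2 (X.δ 3 σ) = X.δ 2 (X.δ 2 σ) := sδ_comm X 2 2 (by decide) σ
  have f0 := hρ.face (X.δ 0 σ)
  have f3 := hρ.face (X.δ 3 σ)
  rw [h12, h22, h02] at f3
  change TensorProduct.map ρ ρ (alexanderWhitney X (sBoundary X 2 (Finsupp.single σ 1))) = 0
  rw [sBoundary_two_single]
  simp only [map_add, map_sub, alexanderWhitney_single, TensorProduct.map_tmul, h00, h01, h02, h22,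
    f0, f3, TensorProduct.tmul_add, TensorProduct.add_tmul]
  abel

/-- The homomorphism `H_2 → H_1 ⊗ H_1` that the comultiplication induces, computed with a
retraction `ρ`: the class of a cycle `z` goes to the image of `z` under
`C_2 → C_1 ⊗ C_1 → H_1 ⊗ H_1`. -/
def comultOf (X : SSet.{u}) (ρ : SChain X 1 →ₗ[ℤ] SHomologySucc X 0)
    (hρ : IsHomologyRetraction X ρ) :
    SHomologySucc X 1 →ₗ[ℤ] SHomologySucc X 0 ⊗[ℤ] SHomologySucc X 0 :=
  Submodule.liftQ _
    ((TensorProduct.map ρ ρ ∘ₗ alexanderWhitney X) ∘ₗ (LinearMap.ker (sBoundary X 1)).subtype) <| by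
    rintro z ⟨c, hc⟩
    rw [LinearMap.mem_ker, LinearMap.comp_apply, ← hc]
    exact hρ.comult_boundary c

/-- `X` is based at `v` if every vertex is joined to `v` by an edge. -/
def EdgeBased (X : SSet.{u}) (v : X _⦋0⦌) : Prop := ∀ x : X _⦋0⦌, Nonempty (SSet.Edge v x)

/-- Retractions exist. -/
lemma EdgeBased.exists_retraction {X : SSet.{u}} {v : X _⦋0⦌} (h : EdgeBased X v) :
    ∃ ρ, IsHomologyRetraction X ρ := by
  let e := fun x => (h x).some
  let E : SChain X 0 →ₗ[ℤ] SChain X 1 :=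
    Finsupp.linearCombination ℤ fun x => Finsupp.single (e x).edge 1
  let P : SChain X 1 →ₗ[ℤ] SChain X 1 := LinearMap.id - E ∘ₗ sBoundary X 0
  have hP : ∀ c, sBoundary X 0 (P c) = 0 := by
    intro c
    suffices h : sBoundary X 0 ∘ₗ P = 0 from LinearMap.congr_fun h c
    refine Finsupp.lhom_ext' fun σ => LinearMap.ext_ring ?_
    simp [P, E, sBoundary_zero_single]
  refine ⟨Submodule.mkQ _ ∘ₗ P.codRestrict (LinearMap.ker (sBoundary X 0)) hP, fun z => ?_⟩
  have hz : P z = z := by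
    have := z.2
    rw [LinearMap.mem_ker] at this
    simp [P, this]
  simp only [LinearMap.comp_apply, Submodule.mkQ_apply]
  congr 1
  exact Subtype.ext hz

/-- The induced homomorphism does not depend on the retraction. -/
lemma EdgeBased.comultOf_eq {X : SSet.{u}} {v : X _⦋0⦌} (h : EdgeBased X v)
    {ρ ρ' : SChain X 1 →ₗ[ℤ] SHomologySucc X 0}
    (hρ : IsHomologyRetraction X ρ) (hρ' : IsHomologyRetraction X ρ') :
    comultOf X ρ hρ = comultOf X ρ' hρ' := by
  let e := fun x => (h x).some
  let s : X _⦋0⦌ → SHomologySucc X 0 := fun x =>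
    ρ (Finsupp.single (e x).edge 1) - ρ' (Finsupp.single (e x).edge 1)
  have hs : ∀ σ : X _⦋1⦌, ρ (Finsupp.single σ 1) =
      ρ' (Finsupp.single σ 1) + (s (X.δ 0 σ) - s (X.δ 1 σ)) := by
    intro σ
    let c : SChain X 1 := Finsupp.single (e (X.δ 1 σ)).edge 1 + Finsupp.single σ 1
      - Finsupp.single (e (X.δ 0 σ)).edge 1
    have hc : sBoundary X 0 c = 0 := by simp [c, sBoundary_zero_single]
    have := (hρ ⟨c, hc⟩).trans (hρ' ⟨c, hc⟩).symm
    simp only [c, map_add, map_sub] at this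
    simp only [s]
    rw [← sub_eq_zero] at this ⊢
    rw [← this]
    abel
  let T : SChain X 1 →ₗ[ℤ] SHomologySucc X 0 ⊗[ℤ] SHomologySucc X 0 :=
    Finsupp.linearCombination ℤ fun σ =>
      s (X.δ 1 σ) ⊗ₜ ρ (Finsupp.single σ 1) - ρ' (Finsupp.single σ 1) ⊗ₜ s (X.δ 0 σ)
  have hT : ∀ c : SChain X 2, TensorProduct.map ρ ρ (alexanderWhitney X c) =
      TensorProduct.map ρ' ρ' (alexanderWhitney X c) + T (sBoundary X 1 c) := by
    intro c
    induction c using Finsupp.induction_linear with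
    | zero => simp only [map_zero, add_zero]
    | add c d hc hd =>
      simp only [map_add] at hc hd ⊢
      rw [hc, hd]
      abel
    | single σ a =>
    suffices h : TensorProduct.map ρ ρ (alexanderWhitney X (Finsupp.single σ 1)) =
        TensorProduct.map ρ' ρ' (alexanderWhitney X (Finsupp.single σ 1)) +
          T (sBoundary X 1 (Finsupp.single σ 1)) by
      have ha : Finsupp.single σ a = a • (Finsupp.single σ 1 : SChain X 2) := by simp
      rw [ha]
      simp only [map_zsmul]
      rw [h, smul_add]
    have h1 : X.δ 0 (X.δ 1 σ) = X.δ 0 (X.δ 0 σ) := sδ_comm X 0 0 le_rfl σ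
    have h2 : X.δ 0 (X.δ 2 σ) = X.δ 1 (X.δ 0 σ) := sδ_comm X 0 1 (by decide) σ
    have h3 : X.δ 1 (X.δ 2 σ) = X.δ 1 (X.δ 1 σ) := sδ_comm X 1 1 le_rfl σ
    have f := hρ'.face σ
    rw [sBoundary_one_single]
    simp only [alexanderWhitney_single, TensorProduct.map_tmul, map_add, map_sub, T,
      Finsupp.linearCombination_single, one_smul, hs, f, h1, h2, h3,
      TensorProduct.tmul_add, TensorProduct.add_tmul, TensorProduct.tmul_sub,
      TensorProduct.sub_tmul]
    abel
  refine Submodule.linearMap_qext _ (LinearMap.ext fun z => ?_)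
  have hz := z.2
  rw [LinearMap.mem_ker] at hz
  have := hT z
  rw [hz, map_zero, add_zero] at this
  exact this

/-! ### Singular homology of a space in degrees one and two -/

/-- The singular simplicial set of a topological space. -/
abbrev Sing (U : Type u) [TopologicalSpace U] : SSet.{u} := TopCat.toSSet.obj (TopCat.of U)

/-- Singular homology `H_1(U; ℤ)`. -/
abbrev SingH₁ (U : Type u) [TopologicalSpace U] : Type u := SHomologySucc (Sing U) 0

/-- Singular homology `H_2(U; ℤ)`. -/
abbrev SingH₂ (U : Type u) [TopologicalSpace U] : Type u := SHomologySucc (Sing U) 1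

lemma exists_edgeBased (U : Type u) [TopologicalSpace U] [PathConnectedSpace U] :
    ∃ v, EdgeBased (Sing U) v := by
  obtain ⟨u⟩ := (inferInstance : Nonempty U)
  refine ⟨TopCat.toSSetObj₀Equiv.symm u, fun x => ?_⟩
  obtain ⟨x, rfl⟩ := TopCat.toSSetObj₀Equiv.symm.surjective x
  exact ⟨TopCat.toSSetObjEdgeEquiv.symm (TopCat.pathEquiv.symm (PathConnectedSpace.somePath u x))⟩

lemma exists_singRetraction (U : Type u) [TopologicalSpace U] [PathConnectedSpace U] :
    ∃ ρ, IsHomologyRetraction (Sing U) ρ :=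
  (exists_edgeBased U).choose_spec.exists_retraction

/-- The homomorphism `H_2(U) → H_1(U) ⊗ H_1(U)` induced by the comultiplication of the singular
chains of a path-connected space `U`. -/
def singComult (U : Type u) [TopologicalSpace U] [PathConnectedSpace U] :
    SingH₂ U →ₗ[ℤ] SingH₁ U ⊗[ℤ] SingH₁ U :=
  comultOf (Sing U) (exists_singRetraction U).choose (exists_singRetraction U).choose_spec

/-- The homomorphism `singComult` can be computed with any retraction. -/
lemma singComult_eq (U : Type u) [TopologicalSpace U] [PathConnectedSpace U]
    {ρ : SChain (Sing U) 1 →ₗ[ℤ] SingH₁ U} (hρ : IsHomologyRetraction (Sing U) ρ) :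
    singComult U = comultOf (Sing U) ρ hρ :=
  (exists_edgeBased U).choose_spec.comultOf_eq _ hρ

/-- `U` has the homotopy type of a CW complex. -/
def HasCWHomotopyType (U : Type u) [TopologicalSpace U] : Prop :=
  ∃ (Y : Type u) (_ : TopologicalSpace Y), T2Space Y ∧
    Nonempty (Topology.CWComplex (Set.univ : Set Y)) ∧ Nonempty (ContinuousMap.HomotopyEquiv U Y)

/-! ### The group ring -/

/-- The augmentation ideal of the group ring `ℤ[G]`: the kernel of the ring homomorphism
`ℤ[G] → ℤ` which sends every `g : G` to `1`. -/
def augmentationIdeal (G : Type u) [Group G] : Ideal (MonoidAlgebra ℤ G) :=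
  RingHom.ker (MonoidAlgebra.lift ℤ ℤ G (1 : G →* ℤ))

end

/-!
A polynomial map of degree `< k` on `G` extends to a linear map on `ℤ[G]` which kills `I ^ k`, so it
is enough to detect the lower central series of `G` by polynomial maps. If the abelianization of `G`
is free, then for every `k ≥ 1` some free group `F` maps onto `G` modulo `γ(G, k)` with kernel in
the commutator subgroup of `F`. A polynomial map on `F` which is additive along that commutator
subgroup descends to `G / γ(G, k)` modulo its values on the kernel, and it still detects `γ(G, k)`
if its zeros lie in `γ(F, k)`.

In degrees one and two the components of the Magnus expansion `w ↦ 1 + m₁ w + m₂ w + m₃ w + ⋯` of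
`F` have these properties. In degree three `m₃ (w * v)` contains the extra term `m₁ w ⊗ m₂ v`, and
for `v` in the commutator subgroup `m₂ v` is a sum of tensors `y ⊗ z - z ⊗ y`. Hence `φ ∘ m₃` is
additive for every linear map `φ` on `A ⊗ A ⊗ A` which is symmetric in the last two arguments. Such
a `φ` is enough, as every linear map on the brackets `[[a, b], c]` is the restriction of one:
antisymmetry and the Jacobi identity are exactly what is needed to solve
`φ a b c - φ b a c = [[a, b], c]` with this symmetry.
-/

open scoped commutatorElement

/-- The lower central series of `G`, indexed from `0` as in Mathlib: `γ(G, 0) = G`. -/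
local notation "γ(" G ", " k ")" => Subgroup.lowerCentralSeries (⊤ : Subgroup G) k

/-! ### Polynomial maps and dimension subgroups -/

/-- `f : G → B` is polynomial of degree `< k`: its `k`-fold iterated differences vanish. -/
def IsPolyDegLT {G B : Type*} [Group G] [AddCommGroup B] (k : ℕ) (f : G → B) : Prop :=
  match k with
  | 0 => ∀ g, f g = 0
  | k + 1 => ∀ h, IsPolyDegLT k fun g => f (g * h) - f g

namespace IsPolyDegLT

variable {G H B C : Type*} [Group G] [Group H] [AddCommGroup B] [AddCommGroup C] {k : ℕ}

lemma zero (k : ℕ) : IsPolyDegLT k (fun _ : G => (0 : B)) := by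
  induction k with
  | zero => exact fun _ => rfl
  | succ k ih => exact fun _ => by simpa only [sub_self] using ih

lemma const (k : ℕ) (b : B) : IsPolyDegLT (k + 1) (fun _ : G => b) :=
  fun _ => by simpa only [sub_self] using zero k

lemma add {f f' : G → B} (hf : IsPolyDegLT k f) (hf' : IsPolyDegLT k f') :
    IsPolyDegLT k (fun g => f g + f' g) := by
  induction k generalizing f f' with
  | zero => exact fun g => by simp only [hf g, hf' g, add_zero]
  | succ k ih => exact fun h => by simpa only [add_sub_add_comm] using ih (hf h) (hf' h)

lemma map {f : G → B} (hf : IsPolyDegLT k f) (φ : B →+ C) :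
    IsPolyDegLT k (fun g => φ (f g)) := by
  induction k generalizing f with
  | zero => exact fun g => by simp only [hf g, map_zero]
  | succ k ih => exact fun h => by simpa only [map_sub] using ih (hf h)

lemma prodMk {f : G → B} {f' : G → C} (hf : IsPolyDegLT k f) (hf' : IsPolyDegLT k f') :
    IsPolyDegLT k (fun g => (f g, f' g)) := by
  simpa using (hf.map (AddMonoidHom.inl B C)).add (hf'.map (AddMonoidHom.inr B C))

lemma succ {f : G → B} (hf : IsPolyDegLT k f) : IsPolyDegLT (k + 1) f := by
  induction k generalizing f with
  | zero => exact fun h g => by simp only [hf (g * h), hf g, sub_zero]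
  | succ k ih => exact fun h => ih (hf h)

lemma comp {f : H → B} (hf : IsPolyDegLT k f) (π : G →* H) :
    IsPolyDegLT k (fun g => f (π g)) := by
  induction k generalizing f with
  | zero => exact fun g => hf (π g)
  | succ k ih => exact fun h => by simpa only [map_mul] using ih (hf (π h))

lemma of_comp {π : G →* H} (hπ : Function.Surjective π) {f : H → B}
    (hf : IsPolyDegLT k fun g => f (π g)) : IsPolyDegLT k f := by
  induction k generalizing f with
  | zero => exact hπ.forall.2 hf
  | succ k ih => exact hπ.forall.2 fun h => ih (by simpa only [map_mul] using hf h)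

end IsPolyDegLT

/-- The `ℤ`-linear extension to the group ring of a function on a group. -/
noncomputable def linExt {G B : Type*} [AddCommGroup B] (f : G → B) :
    MonoidAlgebra ℤ G →ₗ[ℤ] B :=
  Finsupp.linearCombination ℤ f ∘ₗ (MonoidAlgebra.coeffLinearEquiv ℤ).toLinearMap

section LinExt

variable {G B : Type*} [AddCommGroup B]

lemma linExt_single (f : G → B) (g : G) (a : ℤ) :
    linExt f (MonoidAlgebra.single g a) = a • f g := by
  simp [linExt, MonoidAlgebra.coeffLinearEquiv]

lemma linExt_of [Group G] (f : G → B) (g : G) : linExt f (MonoidAlgebra.of ℤ G g) = f g := by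
  rw [MonoidAlgebra.of_apply, linExt_single, one_smul]

lemma linExt_mul_single [Group G] (f : G → B) (x : MonoidAlgebra ℤ G) (h : G) (a : ℤ) :
    linExt f (x * MonoidAlgebra.single h a) =
      a • (linExt (fun g => f (g * h) - f g) x + linExt f x) := by
  induction x using MonoidAlgebra.induction_linear with
  | zero => simp only [zero_mul, map_zero, add_zero, smul_zero]
  | add x y hx hy => rw [add_mul, map_add, hx, hy, map_add, map_add]; module
  | single g b =>
    simp only [MonoidAlgebra.single_mul_single, linExt_single]; module

end LinExt

section DimensionSubgroup

variable {G : Type u} {B : Type*} [Group G] [AddCommGroup B]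

instance : (augmentationIdeal G).IsTwoSided := by
  unfold augmentationIdeal
  infer_instance

lemma of_sub_one_mem_augmentationIdeal (g : G) :
    MonoidAlgebra.of ℤ G g - 1 ∈ augmentationIdeal G := by
  simp [augmentationIdeal, RingHom.mem_ker]

namespace IsPolyDegLT

variable {k : ℕ} {f : G → B}

lemma linExt_eq_zero (hf : IsPolyDegLT k f) {x : MonoidAlgebra ℤ G}
    (hx : x ∈ augmentationIdeal G ^ k) : linExt f x = 0 := by
  induction k generalizing f x with
  | zero =>
    have hf₀ : f = 0 := funext hf
    simp [linExt, hf₀]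
  | succ k ih =>
    rw [Submodule.pow_succ] at hx
    refine Submodule.mul_induction_on hx (fun x hx y hy => ?_) (fun x y hx hy => ?_)
    · have linExt_mul (y : MonoidAlgebra ℤ G) :
          linExt f (x * y) = MonoidAlgebra.lift ℤ ℤ G (1 : G →* ℤ) y • linExt f x := by
        induction y using MonoidAlgebra.induction_linear with
        | zero => simp only [mul_zero, map_zero, zero_smul]
        | add y z hy hz => rw [mul_add, map_add, hy, hz, map_add, add_smul]
        | single h a => rw [linExt_mul_single, ih (hf h) hx]; simp
      rw [linExt_mul, RingHom.mem_ker.1 hy, zero_smul]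
    · rw [map_add, hx, hy, add_zero]

lemma apply_eq_apply_one (hf : IsPolyDegLT k f) {g : G}
    (hg : MonoidAlgebra.of ℤ G g - 1 ∈ augmentationIdeal G ^ k) : f g = f 1 := by
  simpa only [← map_one (MonoidAlgebra.of ℤ G), map_sub, linExt_of, sub_eq_zero]
    using hf.linExt_eq_zero hg

end IsPolyDegLT

/-- The `k`-th integral dimension subgroup of `G`. -/
def dimensionSubgroup (G : Type u) [Group G] (k : ℕ) : Subgroup G where
  carrier := {g | MonoidAlgebra.of ℤ G g - 1 ∈ augmentationIdeal G ^ k}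
  one_mem' := by
    rw [Set.mem_ofPred_eq, map_one, sub_self]
    exact zero_mem _
  mul_mem' {a b} ha hb := by
    have mul_sub_one : MonoidAlgebra.of ℤ G (a * b) - 1 =
        MonoidAlgebra.of ℤ G a * (MonoidAlgebra.of ℤ G b - 1) + (MonoidAlgebra.of ℤ G a - 1) := by
      rw [map_mul]; noncomm_ring
    rw [Set.mem_ofPred_eq, mul_sub_one]
    exact add_mem (Ideal.mul_mem_left _ _ hb) ha
  inv_mem' {a} ha := by
    have inv_sub_one : MonoidAlgebra.of ℤ G a⁻¹ - 1 =
        -(MonoidAlgebra.of ℤ G a⁻¹ * (MonoidAlgebra.of ℤ G a - 1)) := by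
      rw [mul_sub, ← map_mul, inv_mul_cancel, map_one, mul_one, neg_sub]
    rw [Set.mem_ofPred_eq, inv_sub_one]
    exact neg_mem (Ideal.mul_mem_left _ _ ha)

lemma mem_dimensionSubgroup {k : ℕ} {g : G} : g ∈ dimensionSubgroup G k ↔
    MonoidAlgebra.of ℤ G g - 1 ∈ augmentationIdeal G ^ k := Iff.rfl

lemma of_commutatorElement_sub_one (g h : G) : MonoidAlgebra.of ℤ G ⁅g, h⁆ - 1 =
    ((MonoidAlgebra.of ℤ G g - 1) * (MonoidAlgebra.of ℤ G h - 1) -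
      (MonoidAlgebra.of ℤ G h - 1) * (MonoidAlgebra.of ℤ G g - 1)) *
        MonoidAlgebra.of ℤ G (g⁻¹ * h⁻¹) := by
  have bracket : (MonoidAlgebra.of ℤ G g - 1) * (MonoidAlgebra.of ℤ G h - 1) -
      (MonoidAlgebra.of ℤ G h - 1) * (MonoidAlgebra.of ℤ G g - 1) =
        MonoidAlgebra.of ℤ G (g * h) - MonoidAlgebra.of ℤ G (h * g) := by
    simp only [map_mul]; noncomm_ring
  have cancel : h * g * (g⁻¹ * h⁻¹) = 1 := by group
  rw [bracket, sub_mul, ← map_mul, ← map_mul, cancel, map_one, commutatorElement_def,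
    mul_assoc (g * h)]

lemma lowerCentralSeries_le_dimensionSubgroup (k : ℕ) :
    γ(G, k) ≤ dimensionSubgroup G (k + 1) := by
  induction k with
  | zero =>
    intro g _
    rw [mem_dimensionSubgroup, zero_add, Submodule.pow_one]
    exact of_sub_one_mem_augmentationIdeal g
  | succ k ih =>
    rw [Subgroup.lowerCentralSeries_succ, Subgroup.commutator_le]
    intro g hg h _
    have hg' := mem_dimensionSubgroup.1 (ih hg)
    have hh := of_sub_one_mem_augmentationIdeal h
    rw [mem_dimensionSubgroup, of_commutatorElement_sub_one]
    refine Ideal.mul_mem_right _ _ (sub_mem ?_ ?_)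
    · rw [Submodule.pow_succ]
      exact Ideal.mul_mem_mul hg' hh
    · rw [Ideal.IsTwoSided.pow_succ]
      exact Ideal.mul_mem_mul hh hg'

end DimensionSubgroup

/-! ### The truncated Magnus expansion -/

-- Otherwise `A ⊗ A` gets the `ℤ`-module structure of an abelian group, and the associativity of
-- `A ⊗ A ⊗ A` is linear only for the one of a tensor product.
local instance tensorProductModule (A B : Type*) [AddCommGroup A] [AddCommGroup B] [Module ℤ A]
    [Module ℤ B] : Module ℤ (A ⊗[ℤ] B) :=
  TensorProduct.instModule

/-- Elements `1 + x₁ + x₂ + x₃` of the tensor algebra of `A` modulo tensors of degree `≥ 4`,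
under multiplication. -/
@[ext]
structure TruncTensor (A : Type*) [AddCommGroup A] where
  deg₁ : A
  deg₂ : A ⊗[ℤ] A
  deg₃ : A ⊗[ℤ] (A ⊗[ℤ] A)

namespace TruncTensor

variable {A : Type*} [AddCommGroup A]

noncomputable instance : Mul (TruncTensor A) where
  mul x y :=
    { deg₁ := x.deg₁ + y.deg₁
      deg₂ := x.deg₂ + y.deg₂ + x.deg₁ ⊗ₜ y.deg₁
      deg₃ := x.deg₃ + y.deg₃ + TensorProduct.assoc ℤ A A A (x.deg₂ ⊗ₜ y.deg₁)
        + x.deg₁ ⊗ₜ y.deg₂ }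

instance : One (TruncTensor A) := ⟨⟨0, 0, 0⟩⟩

noncomputable instance : Inv (TruncTensor A) where
  inv x :=
    { deg₁ := -x.deg₁
      deg₂ := -x.deg₂ + x.deg₁ ⊗ₜ x.deg₁
      deg₃ := -x.deg₃ + TensorProduct.assoc ℤ A A A (x.deg₂ ⊗ₜ x.deg₁) + x.deg₁ ⊗ₜ x.deg₂
        - x.deg₁ ⊗ₜ (x.deg₁ ⊗ₜ x.deg₁) }

lemma deg₁_mul (x y : TruncTensor A) : (x * y).deg₁ = x.deg₁ + y.deg₁ := rfl

lemma deg₂_mul (x y : TruncTensor A) :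
    (x * y).deg₂ = x.deg₂ + y.deg₂ + x.deg₁ ⊗ₜ y.deg₁ := rfl

lemma deg₃_mul (x y : TruncTensor A) : (x * y).deg₃ =
    x.deg₃ + y.deg₃ + TensorProduct.assoc ℤ A A A (x.deg₂ ⊗ₜ y.deg₁) + x.deg₁ ⊗ₜ y.deg₂ := rfl

lemma deg₁_one : (1 : TruncTensor A).deg₁ = 0 := rfl

lemma deg₂_one : (1 : TruncTensor A).deg₂ = 0 := rfl

lemma deg₃_one : (1 : TruncTensor A).deg₃ = 0 := rfl

lemma deg₁_inv (x : TruncTensor A) : (x⁻¹).deg₁ = -x.deg₁ := rfl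

lemma deg₂_inv (x : TruncTensor A) : (x⁻¹).deg₂ = -x.deg₂ + x.deg₁ ⊗ₜ x.deg₁ := rfl

lemma deg₃_inv (x : TruncTensor A) : (x⁻¹).deg₃ =
    -x.deg₃ + TensorProduct.assoc ℤ A A A (x.deg₂ ⊗ₜ x.deg₁) + x.deg₁ ⊗ₜ x.deg₂
      - x.deg₁ ⊗ₜ (x.deg₁ ⊗ₜ x.deg₁) := rfl

noncomputable instance : Group (TruncTensor A) :=
  Group.ofLeftAxioms
    (fun x y z => by
      ext <;> simp only [deg₁_mul, deg₂_mul, deg₃_mul, tmul_add, add_tmul, map_add,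
        TensorProduct.assoc_tmul] <;> abel)
    (fun x => by
      ext <;> simp only [deg₁_mul, deg₂_mul, deg₃_mul, deg₁_one, deg₂_one, deg₃_one, zero_tmul,
        map_zero, zero_add, add_zero])
    (fun x => by
      ext <;> simp only [deg₁_mul, deg₂_mul, deg₃_mul, deg₁_one, deg₂_one, deg₃_one, deg₁_inv,
        deg₂_inv, deg₃_inv, neg_tmul, add_tmul, map_add, map_neg, TensorProduct.assoc_tmul] <;>
        abel)

end TruncTensor

section Magnus

variable {ι : Type*}

/-- The truncated Magnus expansion `x_i ↦ 1 + e_i` of the free group on `ι`, with values in tensors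
over the free abelian group `ι →₀ ℤ`. -/
noncomputable def magnus : FreeGroup ι →* TruncTensor (ι →₀ ℤ) :=
  FreeGroup.lift fun i => ⟨Finsupp.single i 1, 0, 0⟩

/-- The degree one part of the Magnus expansion: the class of `w` in the abelianization
`ι →₀ ℤ` of the free group. -/
noncomputable def magnus₁ (w : FreeGroup ι) : ι →₀ ℤ := (magnus w).deg₁

/-- The degree two part of the Magnus expansion. -/
noncomputable def magnus₂ (w : FreeGroup ι) : (ι →₀ ℤ) ⊗[ℤ] (ι →₀ ℤ) := (magnus w).deg₂

/-- The degree three part of the Magnus expansion. -/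
noncomputable def magnus₃ (w : FreeGroup ι) : (ι →₀ ℤ) ⊗[ℤ] ((ι →₀ ℤ) ⊗[ℤ] (ι →₀ ℤ)) :=
  (magnus w).deg₃

lemma magnus₁_of (i : ι) : magnus₁ (FreeGroup.of i) = Finsupp.single i 1 := by
  simp only [magnus₁, magnus, FreeGroup.lift_apply_of]

lemma magnus₁_one : magnus₁ (1 : FreeGroup ι) = 0 := by
  rw [magnus₁, map_one, TruncTensor.deg₁_one]

lemma magnus₁_mul (v w : FreeGroup ι) : magnus₁ (v * w) = magnus₁ v + magnus₁ w := by
  simp only [magnus₁, map_mul, TruncTensor.deg₁_mul]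

/-- `magnus₁` as a group homomorphism. -/
noncomputable def magnus₁Hom (ι : Type*) : FreeGroup ι →* Multiplicative (ι →₀ ℤ) :=
  MonoidHom.mk' (fun w => Multiplicative.ofAdd (magnus₁ w)) fun v w => by
    rw [magnus₁_mul, ofAdd_add]

lemma magnus₁_inv (w : FreeGroup ι) : magnus₁ w⁻¹ = -magnus₁ w :=
  map_inv (magnus₁Hom ι) w

lemma magnus₁_zpow (w : FreeGroup ι) (m : ℤ) : magnus₁ (w ^ m) = m • magnus₁ w :=
  map_zpow (magnus₁Hom ι) w m

lemma magnus₂_mul (v w : FreeGroup ι) :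
    magnus₂ (v * w) = magnus₂ v + magnus₂ w + magnus₁ v ⊗ₜ magnus₁ w := by
  simp only [magnus₁, magnus₂, map_mul, TruncTensor.deg₂_mul]

lemma magnus₃_mul (v w : FreeGroup ι) : magnus₃ (v * w) = magnus₃ v + magnus₃ w
    + TensorProduct.assoc ℤ _ _ _ (magnus₂ v ⊗ₜ magnus₁ w) + magnus₁ v ⊗ₜ magnus₂ w := by
  simp only [magnus₁, magnus₂, magnus₃, map_mul, TruncTensor.deg₃_mul]

lemma isPolyDegLT_magnus₁ : IsPolyDegLT 2 (magnus₁ (ι := ι)) := fun h => by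
  simpa only [magnus₁_mul, add_sub_cancel_left] using IsPolyDegLT.const 0 (magnus₁ h)

lemma isPolyDegLT_magnus₂ : IsPolyDegLT 3 (magnus₂ (ι := ι)) := fun h => by
  have hpoly := (IsPolyDegLT.const 1 (magnus₂ h)).add
    (isPolyDegLT_magnus₁.map ((TensorProduct.mk ℤ _ _).flip (magnus₁ h)).toAddMonoidHom)
  convert hpoly using 2 with w
  simp only [magnus₂_mul, LinearMap.toAddMonoidHom_coe, LinearMap.flip_apply,
    TensorProduct.mk_apply]
  abel

lemma isPolyDegLT_magnus₃ : IsPolyDegLT 4 (magnus₃ (ι := ι)) := fun h => by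
  have hpoly := ((IsPolyDegLT.const 2 (magnus₃ h)).add
    (isPolyDegLT_magnus₂.map ((TensorProduct.assoc ℤ _ _ _).toLinearMap ∘ₗ
      (TensorProduct.mk ℤ _ _).flip (magnus₁ h)).toAddMonoidHom)).add
    (isPolyDegLT_magnus₁.succ.map ((TensorProduct.mk ℤ _ _).flip (magnus₂ h)).toAddMonoidHom)
  convert hpoly using 2 with w
  simp only [magnus₃_mul, LinearMap.toAddMonoidHom_coe, LinearMap.flip_apply,
    TensorProduct.mk_apply, LinearMap.comp_apply, LinearEquiv.coe_coe]
  abel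

lemma magnus₁_commutatorElement (v w : FreeGroup ι) : magnus₁ ⁅v, w⁆ = 0 :=
  (map_commutatorElement (magnus₁Hom ι) v w).trans
    (commutatorElement_eq_one_iff_mul_comm.2 (mul_comm _ _))

lemma commutatorElement_mul_mul_swap {G : Type*} [Group G] (v w : G) :
    ⁅v, w⁆ * (w * v) = v * w := by
  rw [commutatorElement_def]; group

lemma magnus₂_commutatorElement (v w : FreeGroup ι) :
    magnus₂ ⁅v, w⁆ = magnus₁ v ⊗ₜ magnus₁ w - magnus₁ w ⊗ₜ magnus₁ v := by
  have h := magnus₂_mul ⁅v, w⁆ (w * v)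
  rw [commutatorElement_mul_mul_swap, magnus₂_mul, magnus₂_mul, magnus₁_commutatorElement,
    zero_tmul, add_zero] at h
  rw [eq_sub_of_add_eq h.symm]
  abel

lemma magnus₃_commutatorElement {v : FreeGroup ι} (hv : magnus₁ v = 0) (w : FreeGroup ι) :
    magnus₃ ⁅v, w⁆ =
      TensorProduct.assoc ℤ _ _ _ (magnus₂ v ⊗ₜ magnus₁ w) - magnus₁ w ⊗ₜ magnus₂ v := by
  have h := magnus₃_mul ⁅v, w⁆ (w * v)
  rw [commutatorElement_mul_mul_swap, magnus₃_mul, magnus₃_mul, magnus₂_commutatorElement,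
    magnus₁_commutatorElement] at h
  simp only [hv, zero_tmul, tmul_zero, sub_self, map_zero, add_zero] at h
  rw [eq_sub_of_add_eq h.symm]
  abel

lemma map_magnus₁_eq {M : Type*} [CommGroup M] {χ : FreeGroup ι →* M}
    {L : (ι →₀ ℤ) →ₗ[ℤ] Additive M}
    (h : ∀ i, L (Finsupp.single i 1) = Additive.ofMul (χ (FreeGroup.of i))) (w : FreeGroup ι) :
    L (magnus₁ w) = Additive.ofMul (χ w) := by
  induction w using FreeGroup.induction_on with
  | C1 => rw [magnus₁_one, map_zero, map_one, ofMul_one]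
  | of i => rw [magnus₁_of, h]
  | inv_of i hi => rw [magnus₁_inv, map_neg, hi, map_inv, ofMul_inv]
  | mul v w hv hw => rw [magnus₁_mul, map_add, hv, hw, map_mul, ofMul_mul]

lemma map_magnus₁_tmul_magnus₁_eq {M : Type*} [CommGroup M]
    {T : FreeGroup ι →* FreeGroup ι →* M} {ψ : (ι →₀ ℤ) ⊗[ℤ] (ι →₀ ℤ) →ₗ[ℤ] Additive M}
    (h : ∀ a b, ψ (Finsupp.single a 1 ⊗ₜ Finsupp.single b 1) =
      Additive.ofMul (T (FreeGroup.of a) (FreeGroup.of b))) (v w : FreeGroup ι) :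
    ψ (magnus₁ v ⊗ₜ magnus₁ w) = Additive.ofMul (T v w) :=
  map_magnus₁_eq (χ := T.flip w) (L := (TensorProduct.curry ψ).flip (magnus₁ w))
    (fun a => map_magnus₁_eq (χ := T (FreeGroup.of a))
      (L := TensorProduct.curry ψ (Finsupp.single a 1)) (h a) w) v

lemma magnus₁_eq_zero_iff {w : FreeGroup ι} : magnus₁ w = 0 ↔ w ∈ γ(FreeGroup ι, 1) := by
  rw [Subgroup.top_lowerCentralSeries_one]
  constructor
  · intro hw
    have h := map_magnus₁_eq (χ := Abelianization.of) (L := Finsupp.linearCombination ℤ fun i : ι =>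
      Additive.ofMul (Abelianization.of (FreeGroup.of i))) (fun i => by simp) w
    rw [hw, map_zero] at h
    rw [← Abelianization.ker_of, MonoidHom.mem_ker]
    exact h.symm
  · exact fun hw => Abelianization.commutator_subset_ker (magnus₁Hom ι) hw

lemma magnus₁_surjective : Function.Surjective (magnus₁ (ι := ι)) := by
  intro x
  induction x using Finsupp.induction_linear with
  | zero => exact ⟨1, magnus₁_one⟩
  | add x y hx hy =>
    obtain ⟨v, rfl⟩ := hx
    obtain ⟨w, rfl⟩ := hy
    exact ⟨v * w, magnus₁_mul v w⟩
  | single i m =>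
    refine ⟨FreeGroup.of i ^ m, ?_⟩
    rw [magnus₁_zpow, magnus₁_of, Finsupp.smul_single, smul_eq_mul, mul_one]

end Magnus

/-! ### Commutators in successive terms of the lower central series -/

section CommutatorPairing

variable {G : Type*} [Group G] {k : ℕ}

/-- The commutator with a term of the lower central series, as an element of the next term. -/
def lcsBracket (v : γ(G, k)) (w : G) : γ(G, k + 1) :=
  ⟨⁅(v : G), w⁆, Subgroup.commutator_mem_commutator v.2 (Subgroup.mem_top w)⟩

lemma coe_lcsBracket (v : γ(G, k)) (w : G) : (lcsBracket v w : G) = ⁅(v : G), w⁆ := rfl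

lemma eq_ofMul_of_eq_on_commutators {M : Type*} [Group M] {f : G → Additive M}
    (hf : ∀ x ∈ γ(G, k + 1), ∀ y ∈ γ(G, k + 1), f (x * y) = f x + f y) {θ : γ(G, k + 1) →* M}
    (h : ∀ (v : γ(G, k)) w, f ⁅(v : G), w⁆ = Additive.ofMul (θ (lcsBracket v w)))
    (x : γ(G, k + 1)) : f x = Additive.ofMul (θ x) := by
  let θ' : γ(G, k + 1) →* M :=
    MonoidHom.mk' (fun x => (f x).toMul) fun x y => congrArg Additive.toMul (hf x x.2 y y.2)
  have le_eqLocus : γ(G, k + 1) ≤ (θ'.eqLocus θ).map (γ(G, k + 1)).subtype :=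
    Subgroup.commutator_le.2 fun v hv w _ => ⟨lcsBracket ⟨v, hv⟩ w, h ⟨v, hv⟩ w, rfl⟩
  obtain ⟨y, hy, hyx⟩ := le_eqLocus x.2
  rwa [Subtype.coe_injective hyx] at hy

lemma map_conjNormal_eq {M : Type*} [Group M] {θ : γ(G, k) →* M}
    (hθ : ∀ x : γ(G, k), (x : G) ∈ γ(G, k + 1) → θ x = 1) (g : G) (x : γ(G, k)) :
    θ (MulAut.conjNormal g x) = θ x := by
  rw [← mul_inv_eq_one, ← map_inv, ← map_mul]
  refine hθ _ ?_
  have conj_mul_inv : (MulAut.conjNormal g x * x⁻¹ : γ(G, k)) = (lcsBracket x g : G)⁻¹ := by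
    rw [coe_lcsBracket, commutatorElement_inv, Subgroup.coe_mul, MulAut.conjNormal_apply,
      Subgroup.coe_inv, commutatorElement_def]
  rw [conj_mul_inv]
  exact inv_mem (lcsBracket x g).2

variable {M : Type*} [CommGroup M]

/-- The pairing `(v, w) ↦ θ ⁅v, w⁆`, bimultiplicative because `θ` vanishes on the next term of the
lower central series and hence is invariant under conjugation. -/
def commutatorPairing (θ : γ(G, k + 1) →* M)
    (hθ : ∀ x : γ(G, k + 1), (x : G) ∈ γ(G, k + 2) → θ x = 1) : γ(G, k) →* G →* M :=
  MonoidHom.mk'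
    (fun v => MonoidHom.mk' (fun w => θ (lcsBracket v w)) fun a b => by
      have right_mul : lcsBracket v (a * b) =
          lcsBracket v a * MulAut.conjNormal a (lcsBracket v b) := by
        ext
        simpa only [coe_lcsBracket, Subgroup.coe_mul, MulAut.conjNormal_apply, mul_assoc]
          using commutatorElement_mul_right_eq_mul_conj (v : G) a b
      rw [right_mul, map_mul, map_conjNormal_eq hθ])
    fun v v' => by
      ext w
      have left_mul : lcsBracket (v * v') w =
          MulAut.conjNormal (v : G) (lcsBracket v' w) * lcsBracket v w := by
        ext
        simpa only [coe_lcsBracket, Subgroup.coe_mul, MulAut.conjNormal_apply]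
          using commutatorElement_mul_left_eq_conj_mul (v : G) v' w
      simp only [MonoidHom.mk'_apply, MonoidHom.mul_apply]
      rw [left_mul, map_mul, map_conjNormal_eq hθ, mul_comm]

lemma commutatorPairing_apply (θ : γ(G, k + 1) →* M)
    (hθ : ∀ x : γ(G, k + 1), (x : G) ∈ γ(G, k + 2) → θ x = 1) (v : γ(G, k)) (w : G) :
    commutatorPairing θ hθ v w = θ (lcsBracket v w) := rfl

/-- The triple commutator `⁅⁅a, b⁆, c⁆`. -/
def tripleBracket (a b c : G) : γ(G, 2) :=
  lcsBracket (lcsBracket (⟨a, Subgroup.mem_top a⟩ : γ(G, 0)) b) c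

lemma coe_tripleBracket (a b c : G) : (tripleBracket a b c : G) = ⁅⁅a, b⁆, c⁆ := rfl

lemma tripleBracket_self (a c : G) : tripleBracket a a c = 1 := by
  ext
  rw [coe_tripleBracket, commutatorElement_self, commutatorElement_one_left, Subgroup.coe_one]

variable {θ : γ(G, 2) →* M}

lemma map_tripleBracket_swap
    (hθ : ∀ x : γ(G, 2), (x : G) ∈ γ(G, 3) → θ x = 1) (a b c : G) :
    θ (tripleBracket b a c) = (θ (tripleBracket a b c))⁻¹ := by
  have swap : lcsBracket (⟨b, Subgroup.mem_top b⟩ : γ(G, 0)) a =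
      (lcsBracket (⟨a, Subgroup.mem_top a⟩ : γ(G, 0)) b)⁻¹ :=
    Subtype.ext (commutatorElement_inv a b).symm
  rw [tripleBracket, swap, ← commutatorPairing_apply θ hθ, map_inv, MonoidHom.inv_apply,
    commutatorPairing_apply, tripleBracket]

lemma map_tripleBracket_conj
    (hθ : ∀ x : γ(G, 2), (x : G) ∈ γ(G, 3) → θ x = 1) (a b c g : G) :
    θ (tripleBracket a b (g * c * g⁻¹)) = θ (tripleBracket a b c) := by
  simp only [tripleBracket, ← commutatorPairing_apply θ hθ, map_mul, map_inv,
    mul_inv_cancel_comm]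

lemma map_tripleBracket_jacobi
    (hθ : ∀ x : γ(G, 2), (x : G) ∈ γ(G, 3) → θ x = 1) (a b c : G) :
    θ (tripleBracket a b c) * θ (tripleBracket b c a) * θ (tripleBracket c a b) = 1 := by
  rw [← map_tripleBracket_conj hθ a b c b, ← map_tripleBracket_conj hθ b c a c,
    ← map_tripleBracket_conj hθ c a b a, ← map_mul, ← map_mul, ← map_one θ]
  exact congrArg θ (Subtype.ext (commutatorElement_commutatorElement_conj_mul a b c))

lemma exists_monoidHom_eq_one_iff_mem_lowerCentralSeries_succ (G : Type u) [Group G] (k : ℕ) :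
    ∃ (M : Type u) (_ : CommGroup M) (θ : γ(G, k) →* M),
      ∀ x, θ x = 1 ↔ (x : G) ∈ γ(G, k + 1) := by
  let N := (γ(G, k + 1)).subgroupOf γ(G, k)
  have quotient_mul_comm (x y : γ(G, k) ⧸ N) : x * y = y * x := by
    induction x using QuotientGroup.induction_on with | H x
    induction y using QuotientGroup.induction_on with | H y
    rw [← commutatorElement_eq_one_iff_mul_comm]
    exact (QuotientGroup.eq_one_iff _).2 (lcsBracket x y).2
  exact ⟨γ(G, k) ⧸ N, { mul_comm := quotient_mul_comm }, QuotientGroup.mk' N,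
    fun x => QuotientGroup.eq_one_iff x⟩

end CommutatorPairing

/-! ### Linear maps on the Magnus expansion -/

section MultilinearExtension

variable {ι B : Type*} [AddCommGroup B]

/-- The linear map on `A ⊗ A`, for `A` free on `ι`, with the given values on the basis. -/
noncomputable def bilinExt (S : ι → ι → B) : (ι →₀ ℤ) ⊗[ℤ] (ι →₀ ℤ) →ₗ[ℤ] B :=
  TensorProduct.lift <| Finsupp.linearCombination ℤ fun a => Finsupp.linearCombination ℤ (S a)

lemma bilinExt_single (S : ι → ι → B) (a b : ι) :
    bilinExt S (Finsupp.single a 1 ⊗ₜ Finsupp.single b 1) = S a b := by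
  simp [bilinExt]

/-- The linear map on `A ⊗ A ⊗ A`, for `A` free on `ι`, with the given values on the basis. -/
noncomputable def trilinExt (S : ι → ι → ι → B) :
    (ι →₀ ℤ) ⊗[ℤ] ((ι →₀ ℤ) ⊗[ℤ] (ι →₀ ℤ)) →ₗ[ℤ] B :=
  TensorProduct.lift <| Finsupp.linearCombination ℤ fun a => bilinExt (S a)

lemma trilinExt_single (S : ι → ι → ι → B) (a b c : ι) :
    trilinExt S (Finsupp.single a 1 ⊗ₜ (Finsupp.single b 1 ⊗ₜ Finsupp.single c 1)) = S a b c := by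
  simp [trilinExt, bilinExt_single]

lemma trilinExt_tmul_comm {S : ι → ι → ι → B} (hS : ∀ a b c, S a b c = S a c b)
    (x y z : ι →₀ ℤ) :
    trilinExt S (x ⊗ₜ (y ⊗ₜ z)) = trilinExt S (x ⊗ₜ (z ⊗ₜ y)) := by
  have comp_comm : trilinExt S ∘ₗ (TensorProduct.comm ℤ _ _).toLinearMap.lTensor _ =
      trilinExt S := by
    ext a b c
    simp [trilinExt_single, hS a c b]
  exact (LinearMap.congr_fun comp_comm (x ⊗ₜ (y ⊗ₜ z))).symm

end MultilinearExtension

section LieForms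

variable {ι M : Type*} [CommGroup M]

lemma map_magnus₂_eq {θ : γ(FreeGroup ι, 1) →* M}
    (hθ : ∀ x : γ(FreeGroup ι, 1), (x : FreeGroup ι) ∈ γ(FreeGroup ι, 2) → θ x = 1)
    {ψ : (ι →₀ ℤ) ⊗[ℤ] (ι →₀ ℤ) →ₗ[ℤ] Additive M}
    (hψ : ∀ a b, ψ (Finsupp.single a 1 ⊗ₜ Finsupp.single b 1) -
      ψ (Finsupp.single b 1 ⊗ₜ Finsupp.single a 1) = Additive.ofMul
        (θ (lcsBracket (⟨.of a, Subgroup.mem_top _⟩ : γ(FreeGroup ι, 0)) (.of b))))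
    (v : γ(FreeGroup ι, 1)) : ψ (magnus₂ (v : FreeGroup ι)) = Additive.ofMul (θ v) := by
  refine eq_ofMul_of_eq_on_commutators (f := fun v => ψ (magnus₂ v))
    (fun v hv w _ => ?_) (fun v w => ?_) v
  · rw [magnus₂_mul, magnus₁_eq_zero_iff.2 hv, zero_tmul, add_zero, map_add]
  · let T : FreeGroup ι →* FreeGroup ι →* M :=
      (commutatorPairing θ hθ).comp (Subgroup.topEquiv (G := FreeGroup ι)).symm.toMonoidHom
    let ψ' := ψ - ψ ∘ₗ (TensorProduct.comm ℤ (ι →₀ ℤ) (ι →₀ ℤ)).toLinearMap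
    rw [magnus₂_commutatorElement, map_sub]
    exact map_magnus₁_tmul_magnus₁_eq (T := T) (ψ := ψ') hψ v w

lemma map_magnus₂_eq_zero {B : Type*} [AddCommGroup B] {ψ : (ι →₀ ℤ) ⊗[ℤ] (ι →₀ ℤ) →ₗ[ℤ] B}
    (hψ : ∀ x y, ψ (x ⊗ₜ y) = ψ (y ⊗ₜ x)) {v : FreeGroup ι} (hv : v ∈ γ(FreeGroup ι, 1)) :
    ψ (magnus₂ v) = 0 :=
  map_magnus₂_eq (M := Multiplicative B) (θ := 1) (ψ := ψ) (fun _ _ => rfl)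
    (fun _ _ => sub_eq_zero.2 (hψ _ _)) ⟨v, hv⟩

lemma map_tmul_magnus₂_eq_zero {B : Type*} [AddCommGroup B]
    {φ : (ι →₀ ℤ) ⊗[ℤ] ((ι →₀ ℤ) ⊗[ℤ] (ι →₀ ℤ)) →ₗ[ℤ] B}
    (hφ : ∀ x y z, φ (x ⊗ₜ (y ⊗ₜ z)) = φ (x ⊗ₜ (z ⊗ₜ y)))
    (x : ι →₀ ℤ) {v : FreeGroup ι} (hv : v ∈ γ(FreeGroup ι, 1)) : φ (x ⊗ₜ magnus₂ v) = 0 :=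
  map_magnus₂_eq_zero (ψ := TensorProduct.curry φ x) (hφ x) hv

lemma map_magnus₃_mul {B : Type*} [AddCommGroup B]
    {φ : (ι →₀ ℤ) ⊗[ℤ] ((ι →₀ ℤ) ⊗[ℤ] (ι →₀ ℤ)) →ₗ[ℤ] B}
    (hφ : ∀ x y z, φ (x ⊗ₜ (y ⊗ₜ z)) = φ (x ⊗ₜ (z ⊗ₜ y)))
    (w : FreeGroup ι) {v : FreeGroup ι} (hv : v ∈ γ(FreeGroup ι, 1)) :
    φ (magnus₃ (w * v)) = φ (magnus₃ w) + φ (magnus₃ v) := by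
  rw [magnus₃_mul, magnus₁_eq_zero_iff.2 hv, tmul_zero, map_zero, add_zero, map_add, map_add,
    map_tmul_magnus₂_eq_zero hφ _ hv, add_zero]

lemma trilinExt_magnus₃_eq {θ : γ(FreeGroup ι, 2) →* M}
    (hθ : ∀ x : γ(FreeGroup ι, 2), (x : FreeGroup ι) ∈ γ(FreeGroup ι, 3) → θ x = 1)
    {S : ι → ι → ι → Additive M} (hsymm : ∀ a b c, S a b c = S a c b)
    (hS : ∀ a b c, S a b c - S b a c =
      Additive.ofMul (θ (tripleBracket (.of a) (.of b) (.of c))))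
    (v : γ(FreeGroup ι, 2)) : trilinExt S (magnus₃ (v : FreeGroup ι)) = Additive.ofMul (θ v) := by
  have hφ := trilinExt_tmul_comm hsymm
  refine eq_ofMul_of_eq_on_commutators (f := fun v => trilinExt S (magnus₃ v))
    (fun v _ w hw => map_magnus₃_mul hφ v
      (Subgroup.lowerCentralSeries_antitone _ one_le_two hw)) (fun v w => ?_) v
  rw [magnus₃_commutatorElement (magnus₁_eq_zero_iff.2 v.2), map_sub,
    map_tmul_magnus₂_eq_zero hφ _ v.2, sub_zero]
  let L : (ι →₀ ℤ) ⊗[ℤ] (ι →₀ ℤ) →ₗ[ℤ] (ι →₀ ℤ) →ₗ[ℤ] Additive M :=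
    TensorProduct.curry (trilinExt S ∘ₗ (TensorProduct.assoc ℤ _ _ _).toLinearMap)
  refine map_magnus₁_eq (χ := commutatorPairing θ hθ v) (L := L (magnus₂ (v : FreeGroup ι)))
    (fun c => ?_) w
  refine map_magnus₂_eq (θ := (commutatorPairing θ hθ).flip (.of c))
    (ψ := L.flip (Finsupp.single c 1))
    (fun x hx => hθ _ (Subgroup.commutator_mem_commutator hx (Subgroup.mem_top _)))
    (fun a b => Eq.trans ?_ (hS a b c)) v
  simp [L, trilinExt_single]

end LieForms

section SymmPreimage

variable {ι A : Type*} [LinearOrder ι] [AddCommGroup A]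

/-- For `C` subject to the identities of the triple brackets `⁅⁅a, b⁆, c⁆`, a solution `S` of
`S a b c - S b a c = C a b c` which is symmetric in the last two arguments. The Jacobi identity
leaves `S a b c` free on the triples whose first entry is smallest, and there it is set to zero. -/
def symmPreimage (C : ι → ι → ι → A) (a b c : ι) : A :=
  if min b c < a then C a (min b c) (max b c) else 0

lemma symmPreimage_symm (C : ι → ι → ι → A) (a b c : ι) :
    symmPreimage C a b c = symmPreimage C a c b := by
  rw [symmPreimage, symmPreimage, min_comm, max_comm]

lemma symmPreimage_sub {C : ι → ι → ι → A} (hself : ∀ a c, C a a c = 0)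
    (hswap : ∀ a b c, C b a c = -C a b c)
    (hjacobi : ∀ a b c, C a b c + C b c a + C c a b = 0) (a b c : ι) :
    symmPreimage C a b c - symmPreimage C b a c = C a b c := by
  wlog h : a ≤ b generalizing a b
  · rw [← neg_sub, this b a (le_of_not_ge h), hswap, neg_neg]
  rcases h.eq_or_lt with rfl | hab
  · rw [sub_self, hself]
  rcases lt_or_ge c a with hca | hac
  · have jacobi_swap : C a c b - C b c a = C a b c := by
      rw [hswap c a b, ← sub_eq_zero, ← neg_eq_zero, ← hjacobi a b c]
      abel
    simpa [symmPreimage, hca, hca.trans hab, hca.le, (hca.trans hab).le] using jacobi_swap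
  · simp [symmPreimage, hab, hab.le, hac, hswap a b c]

end SymmPreimage

lemma mem_lowerCentralSeries_two_of_magnus₂_eq_zero {ι : Type u} {v : FreeGroup ι}
    (hv : v ∈ γ(FreeGroup ι, 1)) (hzero : magnus₂ v = 0) : v ∈ γ(FreeGroup ι, 2) := by
  obtain ⟨M, _, θ, hθ⟩ := exists_monoidHom_eq_one_iff_mem_lowerCentralSeries_succ (FreeGroup ι) 1
  obtain ⟨_, -⟩ := exists_wellFoundedLT ι
  let C (a b : ι) : Additive M :=
    Additive.ofMul (θ (lcsBracket (⟨.of a, Subgroup.mem_top _⟩ : γ(FreeGroup ι, 0)) (.of b)))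
  have C_self (a : ι) : C a a = 0 := by
    rw [← ofMul_one, ← map_one θ]
    exact congrArg (Additive.ofMul ∘ θ) (Subtype.ext (commutatorElement_self _))
  have C_swap (a b : ι) : C b a = -C a b := by
    rw [← ofMul_inv, ← map_inv]
    exact congrArg (Additive.ofMul ∘ θ) (Subtype.ext (commutatorElement_inv _ _).symm)
  let S (a b : ι) : Additive M := if a < b then C a b else 0
  have S_sub (a b : ι) : S a b - S b a = C a b := by
    rcases lt_trichotomy a b with hab | rfl | hba
    · simp [S, hab, hab.not_gt]
    · simp [C_self]
    · simp [S, hba, hba.not_gt, C_swap b a]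
  have h := map_magnus₂_eq (fun x => (hθ x).2) (ψ := bilinExt S)
    (fun a b => by rw [bilinExt_single, bilinExt_single]; exact S_sub a b) ⟨v, hv⟩
  exact (hθ ⟨v, hv⟩).1 (by simpa [hzero] using h.symm)

/-- `f` is a polynomial map on the free group, of degree at most `k` and additive along the
commutator subgroup, whose zeros lie in the term `γ(FreeGroup ι, k)` of the lower central series. -/
structure SeparatesLowerCentralSeries {ι B : Type*} [AddCommGroup B] (k : ℕ)
    (f : FreeGroup ι → B) : Prop where
  isPolyDegLT : IsPolyDegLT (k + 1) f
  map_mul : ∀ w, ∀ v ∈ γ(FreeGroup ι, 1), f (w * v) = f w + f v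
  mem_of_eq_zero : ∀ w, f w = 0 → w ∈ γ(FreeGroup ι, k)

lemma SeparatesLowerCentralSeries.prodMk {ι B C : Type*} [AddCommGroup B]
    [AddCommGroup C] {k : ℕ} {f : FreeGroup ι → B} (hf : SeparatesLowerCentralSeries k f)
    {f' : FreeGroup ι → C} (hpoly : IsPolyDegLT (k + 2) f')
    (hmul : ∀ w, ∀ v ∈ γ(FreeGroup ι, 1), f' (w * v) = f' w + f' v)
    (hmem : ∀ v ∈ γ(FreeGroup ι, k), f' v = 0 → v ∈ γ(FreeGroup ι, k + 1)) :
    SeparatesLowerCentralSeries (k + 1) fun w => (f w, f' w) where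
  isPolyDegLT := hf.isPolyDegLT.succ.prodMk hpoly
  map_mul w v hv := by rw [hf.map_mul w v hv, hmul w v hv, Prod.mk_add_mk]
  mem_of_eq_zero w hw :=
    hmem w (hf.mem_of_eq_zero w (congrArg Prod.fst hw)) (congrArg Prod.snd hw)

lemma separatesLowerCentralSeries_magnus₁ (ι : Type*) :
    SeparatesLowerCentralSeries 1 (magnus₁ (ι := ι)) where
  isPolyDegLT := isPolyDegLT_magnus₁
  map_mul w v _ := magnus₁_mul w v
  mem_of_eq_zero _ := magnus₁_eq_zero_iff.1

lemma separatesLowerCentralSeries_magnus₁_magnus₂ (ι : Type u) :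
    SeparatesLowerCentralSeries 2 fun w : FreeGroup ι => (magnus₁ w, magnus₂ w) :=
  (separatesLowerCentralSeries_magnus₁ ι).prodMk isPolyDegLT_magnus₂
    (fun w v hv => by rw [magnus₂_mul, magnus₁_eq_zero_iff.2 hv, tmul_zero, add_zero])
    (fun _ => mem_lowerCentralSeries_two_of_magnus₂_eq_zero)

lemma exists_separatesLowerCentralSeries_three (ι : Type u) :
    ∃ (B : Type u) (_ : AddCommGroup B) (f : FreeGroup ι → B),
      SeparatesLowerCentralSeries 3 f := by
  obtain ⟨M, _, θ, hθ⟩ := exists_monoidHom_eq_one_iff_mem_lowerCentralSeries_succ (FreeGroup ι) 2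
  have hθ' := fun x => (hθ x).2
  obtain ⟨_, -⟩ := exists_wellFoundedLT ι
  let C (a b c : ι) : Additive M := Additive.ofMul (θ (tripleBracket (.of a) (.of b) (.of c)))
  let S := symmPreimage C
  have S_sub : ∀ a b c, S a b c - S b a c = C a b c := symmPreimage_sub
    (fun a c => by simp only [C, tripleBracket_self, map_one, ofMul_one])
    (fun a b c => congrArg Additive.ofMul (map_tripleBracket_swap hθ' (.of a) (.of b) (.of c)))
    (fun a b c => map_tripleBracket_jacobi hθ' (.of a) (.of b) (.of c))
  refine ⟨_, _, _, (separatesLowerCentralSeries_magnus₁_magnus₂ ι).prodMk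
    (f' := fun w => trilinExt S (magnus₃ w))
    (isPolyDegLT_magnus₃.map (trilinExt S).toAddMonoidHom)
    (fun w v hv => map_magnus₃_mul (trilinExt_tmul_comm (symmPreimage_symm C)) w hv)
    (fun v hv hzero => (hθ ⟨v, hv⟩).1 ?_)⟩
  exact (trilinExt_magnus₃_eq hθ' (symmPreimage_symm C) S_sub ⟨v, hv⟩).symm.trans hzero

/-! ### Groups with free abelianization -/

section Transfer

variable {ι G B : Type*} [Group G] [AddCommGroup B] {k : ℕ}

lemma exists_isPolyDegLT_comp_eq_mk {F : Type*} [Group F] {π : F →* G}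
    (hπ : Function.Surjective π) {f : F → B} (hf : IsPolyDegLT k f)
    (hmul : ∀ w, ∀ v ∈ π.ker, f (w * v) = f w + f v) :
    ∃ (K : AddSubgroup B) (f' : G → B ⧸ K), IsPolyDegLT k f' ∧
      (∀ w, f' (π w) = (f w : B ⧸ K)) ∧ ∀ b, b ∈ K ↔ ∃ v ∈ π.ker, f v = b := by
  let K : AddSubgroup B := (AddMonoidHom.mk' (fun v : Additive π.ker => f v.toMul)
    fun v w => hmul v.toMul w.toMul w.toMul.2).range
  have mem_K (b : B) : b ∈ K ↔ ∃ v ∈ π.ker, f v = b :=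
    ⟨fun ⟨v, hv⟩ => ⟨v.toMul, v.toMul.2, hv⟩, fun ⟨v, hv, h⟩ => ⟨Additive.ofMul ⟨v, hv⟩, h⟩⟩
  have factors : (fun w => (f w : B ⧸ K)).FactorsThrough π := fun v w hvw => by
    have hker : v⁻¹ * w ∈ π.ker := by rw [MonoidHom.mem_ker, map_mul, map_inv, hvw, inv_mul_cancel]
    have hfw := hmul v _ hker
    rw [mul_inv_cancel_left] at hfw
    rw [QuotientAddGroup.eq, hfw, neg_add_cancel_left]
    exact (mem_K _).2 ⟨_, hker, rfl⟩
  obtain ⟨f', hf'⟩ := (Function.factorsThrough_iff _).1 factors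
  refine ⟨K, f', .of_comp hπ ?_, fun w => (congrFun hf' w).symm, mem_K⟩
  rw [show (fun w => f' (π w)) = fun w => (f w : B ⧸ K) from hf'.symm]
  exact hf.map (QuotientAddGroup.mk' K)

lemma map_mem_lowerCentralSeries {F : Type*} [Group F] (π : F →* G) {w : F} (hw : w ∈ γ(F, k)) :
    π w ∈ γ(G, k) := by
  have h := Subgroup.mem_map_of_mem π hw
  rw [Subgroup.map_lowerCentralSeries] at h
  exact Subgroup.lowerCentralSeries_mono k le_top h

lemma dimensionSubgroup_le_lowerCentralSeries {G : Type u} [Group G] {π : FreeGroup ι →* G}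
    (hπ : π.range ⊔ γ(G, k) = ⊤) (hker : γ(G, k).comap π ≤ γ(FreeGroup ι, 1))
    {f : FreeGroup ι → B} (hf : SeparatesLowerCentralSeries k f) :
    dimensionSubgroup G (k + 1) ≤ γ(G, k) := by
  intro g hg
  let q := QuotientGroup.mk' γ(G, k)
  have surjective : Function.Surjective (q.comp π) := by
    refine (QuotientGroup.mk'_surjective _).forall.2 fun x => ?_
    obtain ⟨_, ⟨w, rfl⟩, y, hy, rfl⟩ := Subgroup.mem_sup_of_normal_right.1 (hπ ▸ Subgroup.mem_top x)
    exact ⟨w, QuotientGroup.eq.2 (by rwa [inv_mul_cancel_left])⟩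
  have ker_le : (q.comp π).ker ≤ γ(FreeGroup ι, 1) := by
    rwa [← MonoidHom.comap_ker, QuotientGroup.ker_mk']
  obtain ⟨K, f', hpoly, hf', mem_K⟩ := exists_isPolyDegLT_comp_eq_mk surjective hf.isPolyDegLT
    fun w v hv => hf.map_mul w v (ker_le hv)
  obtain ⟨w, hw⟩ := surjective (q g)
  have f_one : f 1 = 0 := by simpa using hf.map_mul 1 1 (one_mem _)
  have f_mem : f w ∈ K := by
    have h := (hpoly.comp q).apply_eq_apply_one (mem_dimensionSubgroup.1 hg)
    rwa [← hw, map_one, ← map_one (q.comp π), hf', hf', f_one, QuotientAddGroup.mk_zero,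
      QuotientAddGroup.eq_zero_iff] at h
  obtain ⟨v, hv, hvw⟩ := (mem_K _).1 f_mem
  have hwv : w * v⁻¹ ∈ γ(FreeGroup ι, k) := by
    refine hf.mem_of_eq_zero _ (add_right_cancel (b := f v) ?_)
    rw [← hf.map_mul _ v (ker_le hv), inv_mul_cancel_right, zero_add, hvw]
  rw [← QuotientGroup.eq_one_iff]
  change q g = 1
  have h : q (π (w * v⁻¹)) = 1 := (QuotientGroup.eq_one_iff _).2 (map_mem_lowerCentralSeries π hwv)
  have hv' : q (π v) = 1 := hv
  rw [← hw]
  rwa [map_mul, map_mul, map_inv, map_inv, hv', inv_one, mul_one] at h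

end Transfer

section GeneratorsModuloCommutators

variable {G : Type*} [Group G]

lemma sup_lowerCentralSeries_eq_top {K : Subgroup G} (hK : K ⊔ γ(G, 1) = ⊤) (k : ℕ) :
    K ⊔ γ(G, k) = ⊤ := by
  induction k with
  | zero => exact sup_top_eq K
  | succ k ih =>
    let q := QuotientGroup.mk' γ(G, k + 1)
    -- Modulo `γ(G, k + 1)` the subgroup `γ(G, k)` is central, so commutators of products of
    -- elements of `K` and `γ(G, k)` are commutators of elements of `K`.
    have central (x) (hx : x ∈ γ(G, k)) (g : G) : Commute (q x) (q g) := by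
      rw [commute_iff_eq, ← commutatorElement_eq_one_iff_mul_comm, ← map_commutatorElement]
      exact (QuotientGroup.eq_one_iff _).2
        (Subgroup.commutator_mem_commutator hx (Subgroup.mem_top g))
    have commutator_le : γ(G, 1) ≤ K ⊔ γ(G, k + 1) := by
      refine Subgroup.commutator_le.2 fun g _ h _ => ?_
      obtain ⟨a, ha, x, hx, rfl⟩ := Subgroup.mem_sup_of_normal_right.1 (ih ▸ Subgroup.mem_top g)
      obtain ⟨b, hb, y, hy, rfl⟩ := Subgroup.mem_sup_of_normal_right.1 (ih ▸ Subgroup.mem_top h)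
      have bracket_eq : q ⁅a, b⁆ = q ⁅a * x, b * y⁆ := by
        have left (c : G) : ⁅q a * q x, q c⁆ = ⁅q a, q c⁆ := by
          rw [commutatorElement_mul_left_eq_conj_mul, (central x hx c).commutator_eq, mul_one,
            mul_inv_cancel, one_mul]
        have right : ⁅q a, q b * q y⁆ = ⁅q a, q b⁆ := by
          rw [commutatorElement_mul_right_eq_mul_conj, (central y hy a).symm.commutator_eq, mul_one,
            mul_inv_cancel_right]
        rw [map_commutatorElement, map_commutatorElement, map_mul q a, left (b * y), map_mul, right]
      have h := Subgroup.mul_mem_sup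
        (K.mul_mem (K.mul_mem (K.mul_mem ha hb) (K.inv_mem ha)) (K.inv_mem hb))
        (QuotientGroup.eq.1 bracket_eq)
      rwa [← commutatorElement_def, mul_inv_cancel_left] at h
    exact top_unique (hK.ge.trans (sup_le le_sup_left commutator_le))

lemma exists_freeGroup_hom_of_free_abelianization (G : Type u) [Group G]
    [Module.Free ℤ (Additive (Abelianization G))] :
    ∃ (ι : Type u) (π : FreeGroup ι →* G), π.range ⊔ γ(G, 1) = ⊤ ∧
      γ(G, 1).comap π ≤ γ(FreeGroup ι, 1) := by
  let b := Module.Free.chooseBasis ℤ (Additive (Abelianization G))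
  choose g hg using fun i => QuotientGroup.mk'_surjective (commutator G) (b i).toMul
  let π := FreeGroup.lift g
  have of_π (w) : Additive.ofMul (Abelianization.of (π w)) = b.repr.symm (magnus₁ w) := by
    refine (map_magnus₁_eq (χ := Abelianization.of.comp π) (L := b.repr.symm.toLinearMap)
      (fun i => ?_) w).symm
    have hb : b i = Additive.ofMul (Abelianization.of (g i)) := congrArg Additive.ofMul (hg i).symm
    simpa [π] using hb
  refine ⟨_, π, top_unique fun x _ => ?_, fun w hw => ?_⟩
  · obtain ⟨w, hw⟩ := magnus₁_surjective (b.repr (Additive.ofMul (Abelianization.of x)))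
    have hx : (π w)⁻¹ * x ∈ γ(G, 1) := by
      have h := of_π w
      rw [hw, LinearEquiv.symm_apply_apply] at h
      rw [Subgroup.top_lowerCentralSeries_one]
      exact QuotientGroup.eq.1 (Additive.ofMul.injective h)
    simpa only [mul_inv_cancel_left] using
      Subgroup.mul_mem_sup (show π w ∈ π.range from ⟨w, rfl⟩) hx
  · rw [Subgroup.mem_comap, Subgroup.top_lowerCentralSeries_one, ← Abelianization.ker_of,
      MonoidHom.mem_ker] at hw
    rw [← magnus₁_eq_zero_iff, ← b.repr.symm.map_eq_zero_iff, ← of_π, hw, ofMul_one]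

end GeneratorsModuloCommutators

theorem mainTheorem4_general (G : Type u) [Group G] [Module.Free ℤ (Additive (Abelianization G))]
    {k : ℕ} (hk : k ≤ 3) : γ(G, k) = dimensionSubgroup G (k + 1) := by
  refine (lowerCentralSeries_le_dimensionSubgroup k).antisymm ?_
  rcases k.eq_zero_or_pos with rfl | hpos
  · exact le_top
  obtain ⟨ι, π, hrange, hker⟩ := exists_freeGroup_hom_of_free_abelianization G
  have hrange_k := sup_lowerCentralSeries_eq_top hrange k
  have hker_k := (Subgroup.comap_mono (Subgroup.lowerCentralSeries_antitone _ hpos)).trans hker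
  have transfer {B : Type u} [AddCommGroup B] {f : FreeGroup ι → B}
      (hf : SeparatesLowerCentralSeries k f) : dimensionSubgroup G (k + 1) ≤ γ(G, k) :=
    dimensionSubgroup_le_lowerCentralSeries hrange_k hker_k hf
  interval_cases k
  · exact transfer (separatesLowerCentralSeries_magnus₁ ι)
  · exact transfer (separatesLowerCentralSeries_magnus₁_magnus₂ ι)
  · obtain ⟨B, _, f, hf⟩ := exists_separatesLowerCentralSeries_three ι
    exact transfer hf

/-- Here `G = π₁(U, u)`, the `k`-th term `γ_k G` of the lower central series (`γ₁ G = G`) is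
`(⊤ : Subgroup G).lowerCentralSeries (k - 1)`, and `MonoidAlgebra.of ℤ G g` is `g` as an element of
the group ring. -/
theorem mainTheorem4 (U : Type u) [TopologicalSpace U] [PathConnectedSpace U]
    (hCW : HasCWHomotopyType U) (u₀ : U) (n : ℕ)
    (h₁ : Nonempty (Additive (Abelianization (FundamentalGroup U u₀)) ≃+ (Fin n → ℤ)))
    (h₂ : ∃ g : Fin n → FundamentalGroup U u₀, Subgroup.closure (Set.range g) = ⊤)
    (h₃ : Function.Injective (singComult U))
    (k : ℕ) (hk₁ : 1 ≤ k) (hk₄ : k ≤ 4) :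
    (((⊤ : Subgroup (FundamentalGroup U u₀)).lowerCentralSeries (k - 1) :
        Subgroup (FundamentalGroup U u₀)) : Set (FundamentalGroup U u₀)) =
      {g | MonoidAlgebra.of ℤ (FundamentalGroup U u₀) g - 1 ∈
        augmentationIdeal (FundamentalGroup U u₀) ^ k} := by
  obtain ⟨e⟩ := h₁
  have : Module.Free ℤ (Additive (Abelianization (FundamentalGroup U u₀))) :=
    Module.Free.of_equiv e.symm.toIntLinearEquiv
  obtain ⟨k, rfl⟩ := Nat.exists_eq_add_of_le' hk₁
  exact congrArg SetLike.coe (mainTheorem4_general _ (Nat.le_of_succ_le_succ hk₄))
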